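/- Let $d\ge 1$ and $k\ge d$ be fixed integers. A $k$-uniform hypergraph is a pair $H=(V,E)$ with $V$ finite and $E\subseteq\binom{V}{k}$. A convex embedding of $H$ into $\mathbb{R}^d$ is an injective map $f:V\to\mathbb{R}^d$ such that the barycenters $\frac1k\sum_{v\in e}f(v)$, $e\in E$, are pairwise distinct and in convex position (none of them is a convex combination of the others). Let $K^{(k)}_{n,\dots,n}$ be the complete $k$-partite $k$-uniform hypergraph with $k$ parts of $n$ vertices each, whose hyperedges are the sets consisting of exactly one vertex from each part. Let $g_k(n,d)$ be the maximum number of hyperedges of a $k$-uniform hypergraph on $n$ vertices that has a convex embedding into $\mathbb{R}^d$. Then there are subhypergraphs $H_n$ of $K^{(k)}_{n,\dots,n}$, one for each $n$ and with the same vertex set, such that every $H_n$ has a convex embedding into $\mathbb{R}^d$ and the number of hyperedges of $H_n$ is $\Theta(n^{d-1})$ as $n\to\infty$. Consequently $g_k(n,d)=\Omega(n^{d-1})$ as $n\to\infty$. (The implied constants may depend on $k$ and $d$.) -/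

import Mathlib

open Filter Asymptotics

/-- A `k`-uniform hypergraph on the finite vertex set `V`: a set `edges` of `k`-element subsets
of `V`. -/
structure UniformHypergraph (V : Type*) (k : ℕ) where
  /-- the set of hyperedges -/
  edges : Finset (Finset V)
  /-- every hyperedge has exactly `k` vertices -/
  uniform : ∀ e ∈ edges, e.card = k

namespace UniformHypergraph

variable {V : Type*} {k : ℕ}

/-- `H` is a (spanning) subhypergraph of `K`: same vertices, and every hyperedge of `H` is a
hyperedge of `K`. -/
def IsSubhypergraph (H K : UniformHypergraph V k) : Prop :=
  H.edges ⊆ K.edges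

/-- The `k`-barycenter `(1/k) ∑_{v ∈ e} f v` of a set `e` of vertices placed in `ℝ^d` by `f`. -/
noncomputable def barycenter {d : ℕ} (k : ℕ) (f : V → EuclideanSpace ℝ (Fin d)) (e : Finset V) :
    EuclideanSpace ℝ (Fin d) :=
  (1 / (k : ℝ)) • ∑ v ∈ e, f v

/-- A convex embedding of `H` into `ℝ^d`: an injective placement `f` of the vertices for which the
`k`-barycenters of the hyperedges are in convex position. The barycenters are taken as a family
indexed by the hyperedges, so that distinct hyperedges have distinct barycenters. -/
def IsConvexEmbedding (H : UniformHypergraph V k) {d : ℕ}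
    (f : V → EuclideanSpace ℝ (Fin d)) : Prop :=
  Function.Injective f ∧
    ConvexIndependent ℝ (fun e : {e : Finset V // e ∈ H.edges} => barycenter k f e.1)

/-- `H` has a convex embedding into `ℝ^d`. -/
def HasConvexEmbedding (H : UniformHypergraph V k) (d : ℕ) : Prop :=
  ∃ f : V → EuclideanSpace ℝ (Fin d), H.IsConvexEmbedding f

/-- The complete `m`-partite `k`-uniform hypergraph with `m` parts of `n` vertices each. The vertex
`(i, j)` is the `j`-th vertex of the `i`-th part; the hyperedges are the sets of `k` vertices that
contain at most one vertex of each part. -/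
def completeMultipartite (m n k : ℕ) : UniformHypergraph (Fin m × Fin n) k where
  edges := {e ∈ (Finset.univ : Finset (Fin m × Fin n)).powersetCard k |
    ∀ v ∈ e, ∀ w ∈ e, v.1 = w.1 → v = w}
  uniform := fun _ he => (Finset.mem_powersetCard.1 (Finset.mem_filter.1 he).1).2

/-- The possible numbers of hyperedges of `k`-uniform hypergraphs on `n` vertices that have a convex
embedding into `ℝ^d`. -/
def convexEdgeCounts (k n d : ℕ) : Set ℕ :=
  {m | ∃ H : UniformHypergraph (Fin n) k, H.HasConvexEmbedding d ∧ H.edges.card = m}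

/-- `g_k(n,d)`: the maximum number of hyperedges of a `k`-uniform hypergraph on `n` vertices that
has a convex embedding into `ℝ^d`. -/
noncomputable def maxConvexEdges (k n d : ℕ) : ℕ :=
  sSup (convexEdgeCounts k n d)

/-- For `d ≥ 1` the maximum that defines `g_k(n,d)` is attained. -/
theorem isGreatest_maxConvexEdges (k n d : ℕ) (hd : 1 ≤ d) :
    IsGreatest (convexEdgeCounts k n d) (maxConvexEdges k n d) := by
  have hb : BddAbove (convexEdgeCounts k n d) := by
    refine ⟨Fintype.card (Finset (Fin n)), ?_⟩
    rintro m ⟨H, -, rfl⟩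
    exact Finset.card_le_univ _
  have hne : (convexEdgeCounts k n d).Nonempty := by
    refine ⟨0, ⟨∅, by simp⟩, ⟨fun i => EuclideanSpace.single (⟨0, hd⟩ : Fin d) ((i : ℕ) : ℝ), ?_, ?_⟩,
      by simp⟩
    · intro i j hij
      have h := congrArg (fun x : EuclideanSpace ℝ (Fin d) => x ⟨0, hd⟩) hij
      simp only [PiLp.single_apply, if_true] at h
      exact Fin.ext (by exact_mod_cast h)
    · rintro s ⟨e, he⟩
      simp at he
  exact ⟨Nat.sSup_mem hne hb, fun m hm => le_csSup hb hm⟩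

end UniformHypergraph

namespace UniformHypergraph

/-! With `D = d - 1`, let the vertex vary freely in the first `D` parts and fix it in the others:
this gives `n ^ D` transversals. The first `D` parts lie on parabolas in different coordinate
planes, so `k` times a barycenter is `(a, ∑ l, a_l ^ 2 - c)`, with `a` the vector of chosen
parameters and `c` the same for all transversals. These points lie on a paraboloid, hence are in
convex position; `supportFunctional_barycenter_lt` is the tangent hyperplane argument. For `g_k`,
the same construction is run on `n` vertices split into residue classes mod `k`
(`pow_div_le_maxConvexEdges`). -/

/-- The placement of the vertices `(i, j)`, `i < k`, in `ℝ^(D+1)`: for `i < D`, the `i`-th part lies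
on the parabola `x ↦ x • e_i + x² • e_D`; all other parts lie on the negative `e_D`-axis. -/
noncomputable def paraboloidPlacement (k D : ℕ) (v : Fin k × ℕ) :
    EuclideanSpace ℝ (Fin (D + 1)) :=
  WithLp.toLp 2 (Fin.snoc
    (fun l : Fin D => if l.val = v.1.val then (v.2 : ℝ) + 1 else 0)
    (if v.1.val < D then ((v.2 : ℝ) + 1) ^ 2 else -((v.2 * k + v.1.val : ℕ) + 1 : ℝ)))

theorem paraboloidPlacement_castSucc (k D : ℕ) (v : Fin k × ℕ) (l : Fin D) :
    paraboloidPlacement k D v l.castSucc = if l.val = v.1.val then (v.2 : ℝ) + 1 else 0 := by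
  simp [paraboloidPlacement]

theorem paraboloidPlacement_last (k D : ℕ) (v : Fin k × ℕ) :
    paraboloidPlacement k D v (Fin.last D) =
      if v.1.val < D then ((v.2 : ℝ) + 1) ^ 2 else -((v.2 * k + v.1.val : ℕ) + 1 : ℝ) := by
  simp [paraboloidPlacement]

theorem paraboloidPlacement_injective (k D : ℕ) :
    Function.Injective (paraboloidPlacement k D) := by
  rintro ⟨i, x⟩ ⟨j, y⟩ h
  have hlast := congrArg (fun p : EuclideanSpace ℝ (Fin (D + 1)) => p (Fin.last D)) h
  simp only [paraboloidPlacement_last] at hlast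
  have hx : (0 : ℝ) < (x : ℝ) + 1 := by positivity
  have hy : (0 : ℝ) < (y : ℝ) + 1 := by positivity
  by_cases hi : i.val < D
  · have hij : i.val = j.val := by
      have hc := congrArg
        (fun p : EuclideanSpace ℝ (Fin (D + 1)) => p (Fin.castSucc ⟨i.val, hi⟩)) h
      simp only [paraboloidPlacement_castSucc, if_true] at hc
      -- The parabolas meet only at the origin, which the shift by `1` in the parameter avoids.
      by_contra hne
      rw [if_neg hne] at hc
      exact hx.ne' hc
    rw [if_pos hi, if_pos (hij ▸ hi)] at hlast
    have hxy := (pow_left_inj₀ hx.le hy.le two_ne_zero).1 hlast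
    have : x = y := by exact_mod_cast add_right_cancel hxy
    rw [this, Fin.ext hij]
  · by_cases hj : j.val < D
    · rw [if_neg hi, if_pos hj] at hlast
      have h1 : (0 : ℝ) < ((x * k + i.val : ℕ) : ℝ) + 1 := by positivity
      have h2 : (0 : ℝ) < ((y : ℝ) + 1) ^ 2 := by positivity
      linarith
    · rw [if_neg hi, if_neg hj] at hlast
      -- Division with remainder by `k` recovers both the part and the index from the height on the
      -- axis.
      have hN : x * k + i.val = y * k + j.val := by
        have := add_right_cancel (neg_injective hlast)
        exact_mod_cast this
      have hk : 0 < k := i.pos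
      have hmod := congrArg (· % k) hN
      have hdiv := congrArg (· / k) hN
      simp only [Nat.add_comm (_ * k), Nat.add_mul_mod_self_right,
        Nat.add_mul_div_right _ _ hk, Nat.mod_eq_of_lt i.2, Nat.mod_eq_of_lt j.2,
        Nat.div_eq_of_lt i.2, Nat.div_eq_of_lt j.2, Nat.zero_add] at hmod hdiv
      rw [hdiv, Fin.ext hmod]

/-- The linear functional `y ↦ y_D - 2 ∑ l, a_l y_l`. Its restriction to the paraboloid
`y_D = ∑ l, y_l ^ 2` has its only minimum above `a`. -/
def supportFunctional {D : ℕ} (a : Fin D → ℝ) : EuclideanSpace ℝ (Fin (D + 1)) →ₗ[ℝ] ℝ where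
  toFun y := y (Fin.last D) - 2 * ∑ l, a l * y l.castSucc
  map_add' x y := by
    simp only [PiLp.add_apply, mul_add, Finset.sum_add_distrib]
    ring
  map_smul' c x := by
    simp only [PiLp.smul_apply, smul_eq_mul, RingHom.id_apply, mul_left_comm _ c,
      ← Finset.mul_sum]
    ring

theorem supportFunctional_apply {D : ℕ} (a : Fin D → ℝ) (y : EuclideanSpace ℝ (Fin (D + 1))) :
    supportFunctional a y = y (Fin.last D) - 2 * ∑ l, a l * y l.castSucc :=
  rfl

/-- Completing the square: along the parabola only one coordinate of `a` matters, and the minimum is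
at parameter `a_i`. -/
theorem supportFunctional_paraboloidPlacement_of_lt {k D : ℕ} (a : Fin D → ℝ) (i : Fin k) (x : ℕ)
    (hi : i.val < D) :
    supportFunctional a (paraboloidPlacement k D (i, x)) =
      ((x : ℝ) + 1 - a ⟨i, hi⟩) ^ 2 - a ⟨i, hi⟩ ^ 2 := by
  rw [supportFunctional_apply, paraboloidPlacement_last, if_pos hi,
    Finset.sum_eq_single (⟨i, hi⟩ : Fin D)]
  · rw [paraboloidPlacement_castSucc, if_pos rfl]
    ring
  · intro l _ hl
    rw [paraboloidPlacement_castSucc, if_neg fun h => hl (Fin.ext h), mul_zero]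
  · simp

/-- Extends a choice of one vertex in each of the first `D` parts to all `k` parts. -/
def extendChoice (k : ℕ) {D m : ℕ} (hm : 0 < m) (t : Fin D → Fin m) (i : Fin k) : Fin m :=
  if h : i.val < D then t ⟨i, h⟩ else ⟨0, hm⟩

/-- The hyperedge consisting of the chosen vertices, one from each part. -/
def transversal {V : Type*} [DecidableEq V] {k D m : ℕ} (hm : 0 < m) (ψ : Fin k × Fin m → V)
    (t : Fin D → Fin m) : Finset V :=
  Finset.univ.image fun i => ψ (i, extendChoice k hm t i)

section Transversal

variable {V : Type*} {k D m : ℕ} (hm : 0 < m) {ψ : Fin k × Fin m → V}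

theorem injective_transversal_vertex (hψ : ψ.Injective) (t : Fin D → Fin m) :
    Function.Injective fun i => ψ (i, extendChoice k hm t i) :=
  fun _ _ h => congrArg Prod.fst (hψ h)

variable [DecidableEq V]

theorem card_transversal (hψ : ψ.Injective) (t : Fin D → Fin m) :
    (transversal hm ψ t).card = k := by
  rw [transversal, Finset.card_image_of_injective _ (injective_transversal_vertex hm hψ t),
    Finset.card_univ, Fintype.card_fin]

theorem transversal_injective (hD : D ≤ k) (hψ : ψ.Injective) :
    Function.Injective (transversal hm ψ : (Fin D → Fin m) → Finset V) := by
  intro t u h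
  funext l
  let i : Fin k := ⟨l, l.2.trans_le hD⟩
  have hmem : ψ (i, extendChoice k hm t i) ∈ transversal hm ψ u :=
    h ▸ Finset.mem_image_of_mem _ (Finset.mem_univ i)
  obtain ⟨j, -, hj⟩ := Finset.mem_image.1 hmem
  obtain ⟨rfl, hj⟩ := Prod.ext_iff.1 (hψ hj)
  simpa [extendChoice, i] using hj.symm

/-- The hypergraph of all transversals. -/
def transversalHypergraph (D : ℕ) (hψ : ψ.Injective) : UniformHypergraph V k where
  edges := (Finset.univ : Finset (Fin D → Fin m)).image (transversal hm ψ)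
  uniform e he := by
    obtain ⟨t, -, rfl⟩ := Finset.mem_image.1 he
    exact card_transversal hm hψ t

theorem card_edges_transversalHypergraph (hD : D ≤ k) (hψ : ψ.Injective) :
    (transversalHypergraph hm D hψ).edges.card = m ^ D := by
  rw [transversalHypergraph, Finset.card_image_of_injective _ (transversal_injective hm hD hψ)]
  simp

theorem supportFunctional_barycenter_transversal (hψ : ψ.Injective)
    (f : V → EuclideanSpace ℝ (Fin (D + 1))) (a : Fin D → ℝ) (t : Fin D → Fin m) :
    supportFunctional a (barycenter k f (transversal hm ψ t)) =
      1 / (k : ℝ) * ∑ i, supportFunctional a (f (ψ (i, extendChoice k hm t i))) := by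
  rw [barycenter, map_smul, map_sum, smul_eq_mul, transversal,
    Finset.sum_image (injective_transversal_vertex hm hψ t).injOn]

/-- The functional splits over the parts. Each of the first `D` parts is minimized by the choice of
`t`, strictly where `u` differs; the other parts contribute equally, since their vertex is fixed. -/
theorem supportFunctional_barycenter_lt (hk : 0 < k) (hD : D ≤ k) (hψ : ψ.Injective)
    {f : V → EuclideanSpace ℝ (Fin (D + 1))}
    (hf : ∀ i j, f (ψ (i, j)) = paraboloidPlacement k D (i, j.val)) {t u : Fin D → Fin m}
    (htu : u ≠ t) :
    supportFunctional (fun l => ((t l).val : ℝ) + 1) (barycenter k f (transversal hm ψ t)) <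
      supportFunctional (fun l => ((t l).val : ℝ) + 1) (barycenter k f (transversal hm ψ u)) := by
  rw [supportFunctional_barycenter_transversal hm hψ,
    supportFunctional_barycenter_transversal hm hψ]
  refine mul_lt_mul_of_pos_left ?_ (by positivity)
  obtain ⟨l, hl⟩ := Function.ne_iff.1 htu
  refine Finset.sum_lt_sum (fun i _ => ?_) ⟨⟨l, l.2.trans_le hD⟩, Finset.mem_univ _, ?_⟩
  · rw [hf, hf]
    by_cases hi : i.val < D
    · rw [supportFunctional_paraboloidPlacement_of_lt _ _ _ hi,
        supportFunctional_paraboloidPlacement_of_lt _ _ _ hi]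
      simp only [extendChoice, dif_pos hi, sub_self]
      nlinarith [sq_nonneg (((u ⟨i, hi⟩).val : ℝ) + 1 - (((t ⟨i, hi⟩).val : ℝ) + 1))]
    · simp [extendChoice, hi]
  · have hpos : 0 < (((u l).val : ℝ) - ((t l).val : ℝ)) ^ 2 := by
      refine sq_pos_of_ne_zero (sub_ne_zero.2 fun h => hl (Fin.ext ?_))
      exact_mod_cast h
    rw [hf, hf, supportFunctional_paraboloidPlacement_of_lt _ (⟨l, _⟩ : Fin k) _ l.2,
      supportFunctional_paraboloidPlacement_of_lt _ (⟨l, _⟩ : Fin k) _ l.2]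
    simp only [extendChoice, Fin.is_lt, dif_pos, Fin.eta]
    nlinarith

theorem isConvexEmbedding_transversalHypergraph (hk : 0 < k) (hD : D ≤ k) (hψ : ψ.Injective)
    {f : V → EuclideanSpace ℝ (Fin (D + 1))} (hinj : f.Injective)
    (hf : ∀ i j, f (ψ (i, j)) = paraboloidPlacement k D (i, j.val)) :
    (transversalHypergraph hm D hψ).IsConvexEmbedding f := by
  refine ⟨hinj, ?_⟩
  rintro s ⟨e, he⟩ hmem
  obtain ⟨t, -, rfl⟩ := Finset.mem_image.1 he
  by_contra hs
  let g := supportFunctional fun l => ((t l).val : ℝ) + 1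
  let b := barycenter k f (transversal hm ψ t)
  -- All other barycenters lie in an open half-space with `b` on its boundary, so their hull misses
  -- `b`.
  suffices hsub : convexHull ℝ ((fun e : {e : Finset V //
      e ∈ (transversalHypergraph hm D hψ).edges} => barycenter k f e.1) '' s) ⊆
      {y | g b < g y} from lt_irrefl (g b) (hsub hmem)
  refine convexHull_min ?_ (convex_halfSpace_gt g.isLinear (g b))
  rintro _ ⟨⟨e', he'⟩, hes, rfl⟩
  obtain ⟨u, -, rfl⟩ := Finset.mem_image.1 he'
  refine supportFunctional_barycenter_lt hm hk hD hψ hf ?_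
  rintro rfl
  exact hs hes

end Transversal

/-- The complete `k`-partite hypergraph with parts of size `n > 0` has a subhypergraph with `n ^ D`
hyperedges and a convex embedding into `ℝ^(D+1)`. -/
theorem exists_subhypergraph_completeMultipartite {k D n : ℕ} (hk : 0 < k) (hD : D ≤ k)
    (hn : 0 < n) :
    ∃ H : UniformHypergraph (Fin k × Fin n) k, H.IsSubhypergraph (completeMultipartite k n k) ∧
      H.HasConvexEmbedding (D + 1) ∧ H.edges.card = n ^ D := by
  refine ⟨transversalHypergraph hn D (ψ := id) Function.injective_id, ?_,
    ⟨fun v => paraboloidPlacement k D (v.1, v.2.val),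
      isConvexEmbedding_transversalHypergraph hn hk hD _ ?_ fun _ _ => rfl⟩,
    card_edges_transversalHypergraph hn hD _⟩
  · intro e he
    obtain ⟨t, -, rfl⟩ := Finset.mem_image.1 he
    refine Finset.mem_filter.2 ⟨Finset.mem_powersetCard.2
      ⟨Finset.subset_univ _, card_transversal hn Function.injective_id t⟩, ?_⟩
    intro v hv w hw hvw
    obtain ⟨i, -, rfl⟩ := Finset.mem_image.1 hv
    obtain ⟨j, -, rfl⟩ := Finset.mem_image.1 hw
    obtain rfl : i = j := hvw
    rfl
  · rintro ⟨i, x⟩ ⟨j, y⟩ h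
    obtain ⟨h1, h2⟩ := Prod.ext_iff.1 (paraboloidPlacement_injective k D h)
    exact Prod.ext h1 (Fin.ext h2)

theorem pow_div_le_maxConvexEdges {k D n : ℕ} (hk : 0 < k) (hD : D ≤ k) (hn : k ≤ n) :
    (n / k) ^ D ≤ maxConvexEdges k n (D + 1) := by
  have hm : 0 < n / k := Nat.div_pos hn hk
  have hlt (p : Fin k × Fin (n / k)) : p.2.val * k + p.1.val < n :=
    calc p.2.val * k + p.1.val < p.2.val * k + k := by gcongr; exact p.1.2
      _ = (p.2.val + 1) * k := by ring
      _ ≤ n / k * k := Nat.mul_le_mul_right k p.2.2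
      _ ≤ n := Nat.div_mul_le_self n k
  let ψ : Fin k × Fin (n / k) → Fin n := fun p => ⟨p.2.val * k + p.1.val, hlt p⟩
  -- `φ` also covers the vertices left over when `k` does not divide `n`; they lie in no hyperedge
  -- but must be placed injectively.
  let φ : Fin n → Fin k × ℕ := fun v => (⟨v % k, Nat.mod_lt _ hk⟩, v / k)
  have hφψ (i : Fin k) (j : Fin (n / k)) : φ (ψ (i, j)) = (i, j.val) := by
    refine Prod.ext (Fin.ext ?_) ?_
    · simp [φ, ψ, Nat.mod_eq_of_lt i.2]
    · simp [φ, ψ, Nat.add_comm (_ * k), Nat.add_mul_div_right _ _ hk, Nat.div_eq_of_lt i.2]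
  have hψ : ψ.Injective := by
    rintro ⟨i, x⟩ ⟨j, y⟩ h
    have h' := congrArg φ h
    rw [hφψ, hφψ] at h'
    obtain ⟨h1, h2⟩ := Prod.ext_iff.1 h'
    exact Prod.ext h1 (Fin.ext h2)
  have hφ : φ.Injective := by
    intro v w h
    obtain ⟨h1, h2⟩ := Prod.ext_iff.1 h
    have h1 : v.val % k = w.val % k := congrArg Fin.val h1
    have h2 : v.val / k = w.val / k := h2
    exact Fin.ext (by rw [← Nat.div_add_mod v.val k, ← Nat.div_add_mod w.val k, h1, h2])
  refine (isGreatest_maxConvexEdges k n (D + 1) (Nat.le_add_left 1 D)).2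
    ⟨transversalHypergraph hm D hψ, ⟨paraboloidPlacement k D ∘ φ,
      isConvexEmbedding_transversalHypergraph hm hk hD hψ
        ((paraboloidPlacement_injective k D).comp hφ) fun i j => ?_⟩,
      card_edges_transversalHypergraph hm hD hψ⟩
  rw [Function.comp_apply, hφψ]

end UniformHypergraph

theorem corollary6 (k d : ℕ) (hd : 1 ≤ d) (hdk : d ≤ k) :
    (∃ H : (n : ℕ) → UniformHypergraph (Fin k × Fin n) k,
      (∀ n : ℕ,
        (H n).IsSubhypergraph (UniformHypergraph.completeMultipartite k n k) ∧
        (H n).HasConvexEmbedding d) ∧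
      (fun n : ℕ => ((H n).edges.card : ℝ)) =Θ[atTop] (fun n : ℕ => (n : ℝ) ^ (d - 1))) ∧
    (fun n : ℕ => (n : ℝ) ^ (d - 1)) =O[atTop]
      (fun n : ℕ => (UniformHypergraph.maxConvexEdges k n d : ℝ)) := by
  obtain ⟨D, rfl⟩ : ∃ D, d = D + 1 := ⟨d - 1, by omega⟩
  have hk : 0 < k := by omega
  have hD : D ≤ k := by omega
  rw [Nat.add_sub_cancel]
  constructor
  · have hex (n : ℕ) : ∃ H : UniformHypergraph (Fin k × Fin n) k,
        (H.IsSubhypergraph (UniformHypergraph.completeMultipartite k n k) ∧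
          H.HasConvexEmbedding (D + 1)) ∧ (0 < n → H.edges.card = n ^ D) := by
      rcases n.eq_zero_or_pos with rfl | hn
      -- With empty parts there is no vertex to fix, so the empty hypergraph serves.
      · refine ⟨⟨∅, by simp⟩, ⟨Finset.empty_subset _, fun _ => 0, ?_, ?_⟩, fun h => h.false.elim⟩
        · exact fun v => v.2.elim0
        · rintro s ⟨e, he⟩
          simp at he
      · obtain ⟨H, h1, h2, h3⟩ :=
          UniformHypergraph.exists_subhypergraph_completeMultipartite hk hD hn
        exact ⟨H, ⟨h1, h2⟩, fun _ => h3⟩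
    choose H hH hcard using hex
    refine ⟨H, hH, Filter.EventuallyEq.isTheta ?_⟩
    filter_upwards [eventually_gt_atTop 0] with n hn
    rw [hcard n hn, Nat.cast_pow]
  -- For `n ≥ k`, rounding down loses at most a factor `2`: `n ≤ 2 * k * (n / k)`.
  · refine IsBigO.of_bound ((2 * k : ℝ) ^ D) ?_
    filter_upwards [eventually_ge_atTop k] with n hn
    have hle : n ≤ 2 * k * (n / k) := by
      have h1 := Nat.div_add_mod n k
      have h2 := Nat.mod_lt n hk
      have h3 : k * 1 ≤ k * (n / k) := Nat.mul_le_mul_left k (Nat.div_pos hn hk)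
      linarith
    have hmax : n ^ D ≤ (2 * k) ^ D * UniformHypergraph.maxConvexEdges k n (D + 1) :=
      calc n ^ D ≤ (2 * k * (n / k)) ^ D := Nat.pow_le_pow_left hle D
        _ = (2 * k) ^ D * (n / k) ^ D := mul_pow _ _ _
        _ ≤ _ := Nat.mul_le_mul_left _ (UniformHypergraph.pow_div_le_maxConvexEdges hk hD hn)
    rw [Real.norm_of_nonneg (by positivity), Real.norm_of_nonneg (by positivity)]
    exact_mod_cast hmax
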